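/- Let $\lambda>0$ and $R>0$, put $\lambda'=\lambda R$ and $\rho'=e^{-\lambda'}$, and assume $\lambda'\ge\ln 4$. Vehicles stand on a half-line: the first one, $X_1$, is at the origin (it is the first vehicle of a connected component), and the successive distances between neighbouring vehicles are independent and exponentially distributed with rate $\lambda$ (Poisson traffic). The retransmitting vehicles $X_1,X_2,\dots$ are defined recursively: $X_{n+1}$ is the farthest vehicle ahead of $X_n$ within distance $R$ of $X_n$, or the next vehicle after $X_n$ if there is no vehicle ahead within distance $R$. Let $\tau_n$ be the distance from $X_n$ to $X_{n+1}$ and let $N_b=\min\{k\ge 1:\tau_k>R\}$ be the number of hops in the connected component. Let $Q(z)=\sum_{k\ge1}P(N_b=k)z^k$. Then $N_b$ is almost surely finite and integrable, $Q$ is differentiable at $z=1$ with $Q'(1)=E[N_b]$, and if $\lambda'>\ln 4$, $$E[N_b]=\frac{e^{\frac{\lambda'}{2}\sqrt{1-4\rho'}}-\frac{2}{1+\sqrt{1-4\rho'}}\,e^{-\frac{\lambda'}{2}}}{e^{\frac{\lambda'}{2}}-\frac{2}{1+\sqrt{1-4\rho'}}\,e^{\frac{\lambda'}{2}\sqrt{1-4\rho'}}},$$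 where the denominator is nonzero. If $\lambda'=\ln 4$, where the right-hand side reads $0/0$, the formula holds with the right-hand side replaced by its limit as $\lambda'\downarrow\ln 4$. -/

import Mathlib

open MeasureTheory ProbabilityTheory Filter Topology

noncomputable section

/-- Position of vehicle `m` on the road. Vehicle `0` is the first vehicle of a connected component
and sits at the origin; `g k` is the distance between the vehicles `k` and `k + 1`. -/
def vehiclePos (g : ℕ → ℝ) (m : ℕ) : ℝ :=
  ∑ k ∈ Finset.range m, g k

/-- The vehicle that retransmits after vehicle `j`: the farthest vehicle within distance `R`
ahead of `j`, or the next vehicle `j + 1` if vehicle `j` has no vehicle ahead within distance `R`.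
(For positive gaps whose sum is infinite, the set below is finite and contains `j`, and its
maximum is `j` exactly when no vehicle ahead of `j` is covered by `j`.) -/
def nextRetransmitter (g : ℕ → ℝ) (R : ℝ) (j : ℕ) : ℕ :=
  max (j + 1) (sSup {m : ℕ | vehiclePos g m ≤ vehiclePos g j + R})

/-- `retransmitter g R n` is the vehicle `X_{n+1}` of the sequence `X_1, X_2, …` of retransmitting
vehicles; `X_1` is the first vehicle of the component. -/
def retransmitter (g : ℕ → ℝ) (R : ℝ) : ℕ → ℕ
  | 0 => 0
  | n + 1 => nextRetransmitter g R (retransmitter g R n)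

/-- `hopLength g R n` is the distance `τ_{n+1}` between the retransmitting vehicles
`X_{n+1}` and `X_{n+2}`. -/
def hopLength (g : ℕ → ℝ) (R : ℝ) (n : ℕ) : ℝ :=
  vehiclePos g (retransmitter g R (n + 1)) - vehiclePos g (retransmitter g R n)

/-- The number of hops `N_b = min {k ≥ 1 : τ_k > R}`, so that `N_b = k` means that
`τ_1, …, τ_{k-1} ≤ R` and `τ_k > R`. (The value is `0` if there is no such `k`.) -/
def hopCount (g : ℕ → ℝ) (R : ℝ) : ℕ :=
  sInf {k : ℕ | ∃ n, k = n + 1 ∧ R < hopLength g R n}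

/-- The z-transform `Q(z) = ∑_{k ≥ 1} P(N = k) z ^ k` of a random variable `N`. -/
def zTransform {Ω : Type*} [MeasurableSpace Ω] (P : Measure Ω) (N : Ω → ℕ) (z : ℝ) : ℝ :=
  ∑' k : ℕ, P.real {ω | N ω = k + 1} * z ^ (k + 1)

/-- The square root `√(1 - 4ρ')`, where `ρ' = exp (-λ')`. -/
def hopRoot (L : ℝ) : ℝ :=
  Real.sqrt (1 - 4 * Real.exp (-L))

/-- Numerator of the closed form of the mean number of hops; `L` stands for `λ' = λR`. -/
def meanHopsNum (L : ℝ) : ℝ :=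
  Real.exp (L / 2 * hopRoot L) - 2 / (1 + hopRoot L) * Real.exp (-(L / 2))

/-- Denominator of the closed form of the mean number of hops. -/
def meanHopsDen (L : ℝ) : ℝ :=
  Real.exp (L / 2) - 2 / (1 + hopRoot L) * Real.exp (L / 2 * hopRoot L)

end

/-!
The vehicles are scanned one by one, and the scan is a Markov chain that consumes one gap per step.
Its state is the part of the range of the current retransmitter that is still ahead
(`remainingRange`): a gap `x` that fits shortens it from `r` to `r - x`; a longer one makes the
vehicle scanned last the next retransmitter and leaves `R - x`. The component ends at the first gap
that exceeds `R`, and the number of hops is the number of retransmitters found up to then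
(`hasSum_retransmitInd`). This description is pathwise and needs positive gaps only.

Since a gap exceeds `R` with probability `exp (-λ')`, the component ends almost surely, and the tail
of the number of hops is dominated by a geometric sequence of ratio `1 - exp (-λ') < 1`
(`measureReal_hopCount_le`). Hence the number of hops is integrable, the power series `Q` has radius
of convergence greater than `1`, and it may be differentiated term by term at `1`
(`integrable_and_hasDerivAt_zTransform`).

For the mean, let `h` solve the delay equation `h' (t) = λ exp (-λ t) h (R - t)`. Then
`exp (-λ r) h (R - r) + h r - h 0` satisfies the first-step equation of `h 0` times the expected
number of retransmitters found from the state `r` (`integral_hopPotential`), and telescoping along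
the chain gives `h 0 * E[N_b] = h R` (`mul_tsum_integral_retransmitInd`).

Differentiating the delay equation once more yields a linear equation with constant coefficients,
with characteristic polynomial `x ^ 2 + x + ρ'` after scaling by `λ`. Its roots are
`-(1 - s) / 2` and `-(1 + s) / 2`, where `s = √(1 - 4 ρ')`. For `λ' > log 4` they are real and
distinct, an explicit combination of two exponentials solves the delay equation, and
`h 0 * E[N_b] = h R` becomes the closed form; its denominator cannot vanish, since the numerator
would vanish with it and force the roots to coincide. For `λ' = log 4` the root is double, and the
solution `(2 - λ' + 2 λ t) exp (-λ t / 2)` gives the value `(1 + λ' / 2) / (2 - λ')`, which is also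
the limit of the closed form, as seen from its expansion in `s` at `s = 0`.
-/

/-! ### Scanning the vehicles one by one -/

/-- The remaining range after the next vehicle, at distance `x`, has been scanned, if the remaining
range was `r` before. Inside the range it shrinks by `x`; otherwise the vehicle scanned last
retransmits, and its range `R` has been used up by `x`. -/
noncomputable def rangeStep (R r x : ℝ) : ℝ :=
  if x ≤ r then r - x else R - x

/-- The part of the range of the current retransmitter that lies ahead of vehicle `m`. The scan
starts with range `0`, as if vehicle `0` were the last one covered by an earlier retransmitter. -/
noncomputable def remainingRange (g : ℕ → ℝ) (R : ℝ) : ℕ → ℝ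
  | 0 => 0
  | m + 1 => rangeStep R (remainingRange g R m) (g m)

/-- The indicator of the event that vehicle `m` belongs to the connected component of vehicle `0`,
i.e. that the first `m` gaps are at most `R`. -/
noncomputable def connectedInd (g : ℕ → ℝ) (R : ℝ) (m : ℕ) : ℝ :=
  ∏ k ∈ Finset.range m, if g k ≤ R then 1 else 0

/-- The indicator of the event that vehicle `m` belongs to the component and retransmits. -/
noncomputable def retransmitInd (g : ℕ → ℝ) (R : ℝ) (m : ℕ) : ℝ :=
  connectedInd g R m * if remainingRange g R m < g m then 1 else 0

lemma vehiclePos_succ (g : ℕ → ℝ) (m : ℕ) : vehiclePos g (m + 1) = vehiclePos g m + g m := by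
  simp [vehiclePos, Finset.sum_range_succ]

lemma vehiclePos_strictMono {g : ℕ → ℝ} (hg : ∀ k, 0 < g k) : StrictMono (vehiclePos g) :=
  strictMono_nat_of_lt_succ fun m => by rw [vehiclePos_succ]; linarith [hg m]

lemma nextRetransmitter_eq {g : ℕ → ℝ} (hg : ∀ k, 0 < g k) {R : ℝ} {j m : ℕ}
    (h1 : vehiclePos g m ≤ vehiclePos g j + R) (h2 : vehiclePos g j + R < vehiclePos g (m + 1)) :
    nextRetransmitter g R j = max (j + 1) m := by
  have hS : IsGreatest {i : ℕ | vehiclePos g i ≤ vehiclePos g j + R} m :=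
    ⟨h1, fun i hi => Nat.lt_succ_iff.1
      ((vehiclePos_strictMono hg).lt_iff_lt.1 (lt_of_le_of_lt hi h2))⟩
  rw [nextRetransmitter, hS.csSup_eq]

/-- The state of the scan at a vehicle `m + 1` of the component: `i + 1` retransmitters have been
found, all behind that vehicle, and the last of them still covers it. -/
lemma scan_invariant {g : ℕ → ℝ} (hg : ∀ k, 0 < g k) {R : ℝ} {K : ℕ} (hlt : ∀ k < K, g k ≤ R)
    (m : ℕ) (hm : m + 1 ≤ K) :
    ∃ i, (∑ k ∈ Finset.range (m + 1), if remainingRange g R k < g k then 1 else 0) = i + 1 ∧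
      retransmitter g R i ≤ m ∧
      vehiclePos g (retransmitter g R i) + R = vehiclePos g (m + 1) + remainingRange g R (m + 1) ∧
      0 ≤ remainingRange g R (m + 1) ∧ ∀ j < i, hopLength g R j ≤ R := by
  induction m with
  | zero =>
    have h0 := hlt 0 hm
    refine ⟨0, ?_, le_rfl, ?_, ?_, by simp⟩
    · rw [zero_add, Finset.sum_range_one, if_pos (by simpa [remainingRange] using hg 0)]
    · simp [retransmitter, remainingRange, rangeStep, (hg 0).not_ge, vehiclePos]
    · simpa [remainingRange, rangeStep, (hg 0).not_ge] using h0
  | succ m ih =>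
    obtain ⟨i, hc, hle, hpos, hr, hj⟩ := ih (by omega)
    have hR := hlt (m + 1) hm
    have hs := vehiclePos_succ g (m + 1)
    rcases le_or_gt (g (m + 1)) (remainingRange g R (m + 1)) with h | h
    · refine ⟨i, ?_, by omega, ?_, ?_, hj⟩
      · rw [Finset.sum_range_succ, hc, if_neg h.not_gt]
      · rw [remainingRange, rangeStep, if_pos h]; linarith
      · rw [remainingRange, rangeStep, if_pos h]; linarith
    · have hnext : retransmitter g R (i + 1) = m + 1 := by
        rw [retransmitter, nextRetransmitter_eq hg (m := m + 1) (by linarith) (by linarith)]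
        omega
      refine ⟨i + 1, ?_, by omega, ?_, ?_, ?_⟩
      · rw [Finset.sum_range_succ, hc, if_pos h]
      · rw [remainingRange, rangeStep, if_neg h.not_ge, hnext]; linarith
      · rw [remainingRange, rangeStep, if_neg h.not_ge]; linarith
      · intro j hji
        rcases Nat.lt_succ_iff_lt_or_eq.1 hji with h' | rfl
        · exact hj j h'
        · rw [hopLength, hnext]; linarith

lemma hopCount_eq {g : ℕ → ℝ} {R : ℝ} {i : ℕ} (h1 : R < hopLength g R i)
    (h2 : ∀ j < i, hopLength g R j ≤ R) : hopCount g R = i + 1 := by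
  have : IsLeast {k : ℕ | ∃ n, k = n + 1 ∧ R < hopLength g R n} (i + 1) := by
    refine ⟨⟨i, rfl, h1⟩, ?_⟩
    rintro k ⟨n, rfl, hn⟩
    by_contra! hlt
    exact (h2 n (by omega)).not_gt hn
  exact this.csInf_eq

lemma hopLength_of_gap {g : ℕ → ℝ} (hg : ∀ k, 0 < g k) {R : ℝ} (hR : 0 < R) {K i : ℕ}
    (hK : R < g K) (hi : retransmitter g R i = K) : hopLength g R i = g K := by
  have hs := vehiclePos_succ g K
  rw [hopLength, retransmitter, hi, nextRetransmitter_eq hg (m := K) (by linarith) (by linarith),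
    max_eq_left (by omega)]
  linarith

/-- If gap `K` is the first one that exceeds `R`, the number of hops is the number of vehicles
among `0, …, K` that lie outside the range of the retransmitter found before. -/
lemma hopCount_eq_sum {g : ℕ → ℝ} (hg : ∀ k, 0 < g k) {R : ℝ} (hR : 0 < R) {K : ℕ}
    (hK : R < g K) (hlt : ∀ k < K, g k ≤ R) :
    (∃ n, R < hopLength g R n) ∧
    hopCount g R = ∑ k ∈ Finset.range (K + 1), if remainingRange g R k < g k then 1 else 0 := by
  rcases K with _ | m
  · have h0 : R < hopLength g R 0 := by rwa [hopLength_of_gap hg hR hK rfl]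
    refine ⟨⟨0, h0⟩, ?_⟩
    rw [hopCount_eq h0 (by simp), zero_add, Finset.sum_range_one,
      if_pos (by simpa [remainingRange] using hg 0)]
  · obtain ⟨i, hc, hle, hpos, hr, hj⟩ := scan_invariant hg hlt m le_rfl
    have hlt' := vehiclePos_strictMono hg (Nat.lt_succ_of_le hle)
    have hs := vehiclePos_succ g (m + 1)
    have hnext : retransmitter g R (i + 1) = m + 1 := by
      rw [retransmitter, nextRetransmitter_eq hg (m := m + 1) (by linarith) (by linarith)]
      omega
    have h0 : R < hopLength g R (i + 1) := by rwa [hopLength_of_gap hg hR hK hnext]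
    refine ⟨⟨_, h0⟩, ?_⟩
    rw [Finset.sum_range_succ, hc, if_pos (by linarith), hopCount_eq h0]
    intro j hji
    rcases Nat.lt_succ_iff_lt_or_eq.1 hji with h' | rfl
    · exact hj j h'
    · rw [hopLength, hnext]; linarith

lemma connectedInd_eq_one {g : ℕ → ℝ} {R : ℝ} {m : ℕ} (h : ∀ k < m, g k ≤ R) :
    connectedInd g R m = 1 :=
  Finset.prod_eq_one fun k hk => if_pos (h k (Finset.mem_range.1 hk))

lemma connectedInd_eq_zero {g : ℕ → ℝ} {R : ℝ} {m k : ℕ} (hk : k < m) (h : R < g k) :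
    connectedInd g R m = 0 :=
  Finset.prod_eq_zero (Finset.mem_range.2 hk) (if_neg h.not_ge)

lemma connectedInd_eq_one_or_zero (g : ℕ → ℝ) (R : ℝ) (m : ℕ) :
    ((∀ k < m, g k ≤ R) ∧ connectedInd g R m = 1) ∨ connectedInd g R m = 0 := by
  by_cases h : ∀ k < m, g k ≤ R
  · exact .inl ⟨h, connectedInd_eq_one h⟩
  · push Not at h
    obtain ⟨k, hk, h⟩ := h
    exact .inr (connectedInd_eq_zero hk h)

lemma connectedInd_nonneg (g : ℕ → ℝ) (R : ℝ) (m : ℕ) : 0 ≤ connectedInd g R m := by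
  rcases connectedInd_eq_one_or_zero g R m with ⟨-, h⟩ | h <;> simp [h]

lemma connectedInd_le_one (g : ℕ → ℝ) (R : ℝ) (m : ℕ) : connectedInd g R m ≤ 1 := by
  rcases connectedInd_eq_one_or_zero g R m with ⟨-, h⟩ | h <;> simp [h]

lemma retransmitInd_nonneg (g : ℕ → ℝ) (R : ℝ) (m : ℕ) : 0 ≤ retransmitInd g R m := by
  refine mul_nonneg (connectedInd_nonneg g R m) ?_
  split_ifs <;> simp

lemma retransmitInd_le (g : ℕ → ℝ) (R : ℝ) (m : ℕ) :
    retransmitInd g R m ≤ connectedInd g R m := by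
  refine mul_le_of_le_one_right (connectedInd_nonneg g R m) ?_
  split_ifs <;> simp

lemma remainingRange_mem_Icc {g : ℕ → ℝ} (hg : ∀ k, 0 < g k) {R : ℝ} (hR : 0 < R) {m : ℕ}
    (h : ∀ k < m, g k ≤ R) : remainingRange g R m ∈ Set.Icc 0 R := by
  induction m with
  | zero => exact ⟨le_rfl, hR.le⟩
  | succ m ih =>
    obtain ⟨h0, h1⟩ := ih fun k hk => h k (by omega)
    have := h m (by omega)
    have := hg m
    rw [remainingRange, rangeStep]
    split_ifs <;> constructor <;> linarith

/-- Every hop starts at its own vehicle of the component, so the number of hops is the number of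
retransmitting vehicles of the component. -/
lemma hasSum_retransmitInd {g : ℕ → ℝ} (hg : ∀ k, 0 < g k) {R : ℝ} (hR : 0 < R)
    (h : ∃ K, R < g K) :
    (∃ n, R < hopLength g R n) ∧ HasSum (retransmitInd g R) (hopCount g R) ∧
      ∀ n < hopCount g R, connectedInd g R n = 1 := by
  classical
  have hK := Nat.find_spec h
  have hlt : ∀ k < Nat.find h, g k ≤ R := fun k hk => not_lt.1 (Nat.find_min h hk)
  obtain ⟨h1, h2⟩ := hopCount_eq_sum hg hR hK hlt
  refine ⟨h1, ?_, fun n hn => connectedInd_eq_one fun k hk => hlt k ?_⟩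
  · have : ((hopCount g R : ℕ) : ℝ) = ∑ k ∈ Finset.range (Nat.find h + 1), retransmitInd g R k := by
      rw [h2, Nat.cast_sum]
      refine Finset.sum_congr rfl fun k hk => ?_
      rw [retransmitInd, connectedInd_eq_one fun j hj => hlt j ?_, one_mul]
      · push_cast; rfl
      · have := Finset.mem_range.1 hk; omega
    rw [this]
    refine hasSum_sum_of_ne_finset_zero fun k hk => ?_
    rw [retransmitInd, connectedInd_eq_zero (k := Nat.find h) ?_ hK, zero_mul]
    simpa using hk
  · have : hopCount g R ≤ Nat.find h + 1 := by
      rw [h2]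
      refine (Finset.sum_le_card_nsmul _ _ 1 fun k _ => ?_).trans (by simp)
      split_ifs <;> simp
    omega

/-! ### The exponential law -/

lemma integral_expMeasure {lam : ℝ} (hlam : 0 < lam) (f : ℝ → ℝ) :
    ∫ x, f x ∂(expMeasure lam) = ∫ x in Set.Ioi 0, lam * Real.exp (-(lam * x)) * f x := by
  have h : expMeasure lam = volume.withDensity (exponentialPDF lam) := rfl
  rw [h, integral_withDensity_eq_integral_toReal_smul
    (by unfold exponentialPDF; fun_prop) (ae_of_all _ fun x => by simp [exponentialPDF])]
  rw [← integral_Ici_eq_integral_Ioi, ← integral_indicator measurableSet_Ici]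
  congr 1 with x
  rw [exponentialPDF_eq]
  by_cases hx : 0 ≤ x
  · rw [if_pos hx, Set.indicator_of_mem (by exact hx), ENNReal.toReal_ofReal (by positivity),
      smul_eq_mul]
  · rw [if_neg hx, Set.indicator_of_notMem (by exact hx)]; simp

lemma ae_pos_expMeasure (lam : ℝ) : ∀ᵐ x ∂(expMeasure lam), 0 < x := by
  have h : expMeasure lam = volume.withDensity (exponentialPDF lam) := rfl
  rw [h, ae_withDensity_iff (by unfold exponentialPDF; fun_prop)]
  have h0 : ∀ᵐ x : ℝ, x ≠ 0 := by simp [ae_iff]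
  filter_upwards [h0] with x hx hd
  by_contra! hle
  exact hd (exponentialPDF_of_neg (lt_of_le_of_ne hle hx))

lemma expMeasure_real_Iic {lam : ℝ} (hlam : 0 < lam) {x : ℝ} (hx : 0 ≤ x) :
    (expMeasure lam).real (Set.Iic x) = 1 - Real.exp (-(lam * x)) := by
  have := isProbabilityMeasure_expMeasure hlam
  rw [← cdf_eq_real, cdf_expMeasure_eq hlam, if_pos hx]

lemma expMeasure_real_Ioi {lam : ℝ} (hlam : 0 < lam) {x : ℝ} (hx : 0 ≤ x) :
    (expMeasure lam).real (Set.Ioi x) = Real.exp (-(lam * x)) := by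
  have := isProbabilityMeasure_expMeasure hlam
  rw [← Set.compl_Iic, probReal_compl_eq_one_sub measurableSet_Iic, expMeasure_real_Iic hlam hx]
  ring

lemma integral_expMeasure_indicator_le {lam : ℝ} (hlam : 0 < lam) {R : ℝ} (hR : 0 ≤ R) :
    ∫ x, (if x ≤ R then (1 : ℝ) else 0) ∂(expMeasure lam) = 1 - Real.exp (-(lam * R)) := by
  rw [← expMeasure_real_Iic hlam hR, ← integral_indicator_one measurableSet_Iic]
  congr 1

lemma integral_expMeasure_indicator_gt {lam : ℝ} (hlam : 0 < lam) {r : ℝ} (hr : 0 ≤ r) :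
    ∫ x, (if r < x then (1 : ℝ) else 0) ∂(expMeasure lam) = Real.exp (-(lam * r)) := by
  rw [← expMeasure_real_Ioi hlam hr, ← integral_indicator_one measurableSet_Ioi]
  congr 1

/-! ### The first-step equation -/

/-- For a solution `h` of `h' (t) = λ exp (-λ t) h (R - t)`, the value `hopPotential lam R h r` is
`h 0` times the expected number of retransmitters still to be found in the scan when the remaining
range is `r`. -/
noncomputable def hopPotential (lam R : ℝ) (h : ℝ → ℝ) (r : ℝ) : ℝ :=
  Real.exp (-(lam * r)) * h (R - r) + h r - h 0

lemma hopPotential_zero (lam R : ℝ) (h : ℝ → ℝ) : hopPotential lam R h 0 = h R := by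
  simp [hopPotential]

/-- The density of the exponential law times the potential `hopPotential lam R h (c - x)` is the
derivative of `-exp (-λ x) (h (c - x) - h 0)`. -/
lemma hasDerivAt_hopPotential {lam R : ℝ} {h : ℝ → ℝ}
    (hh : ∀ t, HasDerivAt h (lam * Real.exp (-(lam * t)) * h (R - t)) t) (c x : ℝ) :
    HasDerivAt (fun x => -(Real.exp (-(lam * x)) * (h (c - x) - h 0)))
      (lam * Real.exp (-(lam * x)) * hopPotential lam R h (c - x)) x := by
  have h1 : HasDerivAt (fun x => Real.exp (-(lam * x))) (Real.exp (-(lam * x)) * (-(lam * 1))) x :=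
    (((hasDerivAt_id x).const_mul lam).neg).exp
  have h2 : HasDerivAt (fun x => h (c - x) - h 0)
      (lam * Real.exp (-(lam * (c - x))) * h (R - (c - x)) * (-1)) x :=
    ((hh (c - x)).comp x ((hasDerivAt_id x).const_sub c)).sub_const _
  convert! (h1.mul h2).neg using 1
  rw [hopPotential]
  ring

lemma exists_bound_hopPotential {lam R : ℝ} {h : ℝ → ℝ} (hcont : Continuous h) :
    ∃ C, ∀ r ∈ Set.Icc 0 R, |hopPotential lam R h r| ≤ C := by
  have hU : Continuous (hopPotential lam R h) := by unfold hopPotential; fun_prop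
  exact isCompact_Icc.exists_bound_of_continuousOn hU.continuousOn

/-- First-step analysis: the potential before a vehicle is scanned is the mean of the potential
after it (on the event that the component goes on), plus `h 0` times the probability that the scan
finds a new retransmitter. -/
lemma integral_hopPotential {lam R : ℝ} (hlam : 0 < lam) {h : ℝ → ℝ}
    (hh : ∀ t, HasDerivAt h (lam * Real.exp (-(lam * t)) * h (R - t)) t) {r : ℝ}
    (hr : r ∈ Set.Icc 0 R) :
    ∫ x, ((if x ≤ R then 1 else 0) * hopPotential lam R h (rangeStep R r x)
      + h 0 * if r < x then 1 else 0) ∂(expMeasure lam) = hopPotential lam R h r := by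
  obtain ⟨hr0, hrR⟩ := hr
  have := isProbabilityMeasure_expMeasure hlam
  have hcont : Continuous h := continuous_iff_continuousAt.2 fun t => (hh t).continuousAt
  have hU : Continuous (hopPotential lam R h) := by unfold hopPotential; fun_prop
  have hstep : Measurable (rangeStep R r) := by
    unfold rangeStep
    exact Measurable.ite measurableSet_Iic (by fun_prop) (by fun_prop)
  have hd (c : ℝ) : Continuous fun x => lam * Real.exp (-(lam * x)) * hopPotential lam R h (c - x) := by
    fun_prop
  have hint : ∫ x, (if x ≤ R then 1 else 0) * hopPotential lam R h (rangeStep R r x)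
      ∂(expMeasure lam) = h r - h 0 + Real.exp (-(lam * r)) * (h (R - r) - h 0) := by
    rw [integral_expMeasure hlam]
    have e1 : ∫ x in Set.Ioi 0, lam * Real.exp (-(lam * x)) *
        ((if x ≤ R then 1 else 0) * hopPotential lam R h (rangeStep R r x)) =
        ∫ x in (0 : ℝ)..R, lam * Real.exp (-(lam * x)) * hopPotential lam R h (rangeStep R r x) := by
      rw [intervalIntegral.integral_of_le (hr0.trans hrR), ← integral_indicator measurableSet_Ioi,
        ← integral_indicator measurableSet_Ioc]
      congr 1 with x
      by_cases h0 : 0 < x <;> by_cases h1 : x ≤ R <;> simp [Set.indicator, h0, h1]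
    have i1 : Set.EqOn
        (fun x => lam * Real.exp (-(lam * x)) * hopPotential lam R h (r - x))
        (fun x => lam * Real.exp (-(lam * x)) * hopPotential lam R h (rangeStep R r x))
        (Set.uIoo 0 r) := by
      intro x hx
      rw [Set.uIoo_of_le hr0] at hx
      simp [rangeStep, hx.2.le]
    have i2 : Set.EqOn
        (fun x => lam * Real.exp (-(lam * x)) * hopPotential lam R h (R - x))
        (fun x => lam * Real.exp (-(lam * x)) * hopPotential lam R h (rangeStep R r x))
        (Set.uIoo r R) := by
      intro x hx
      rw [Set.uIoo_of_le hrR] at hx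
      simp [rangeStep, hx.1.not_ge]
    rw [e1, ← intervalIntegral.integral_add_adjacent_intervals (b := r)
      (((hd r).intervalIntegrable 0 r).congr_uIoo i1) (((hd R).intervalIntegrable r R).congr_uIoo i2),
      ← intervalIntegral.integral_congr_uIoo i1, ← intervalIntegral.integral_congr_uIoo i2,
      intervalIntegral.integral_eq_sub_of_hasDerivAt
        (fun x _ => hasDerivAt_hopPotential hh r x) ((hd r).intervalIntegrable 0 r),
      intervalIntegral.integral_eq_sub_of_hasDerivAt
        (fun x _ => hasDerivAt_hopPotential hh R x) ((hd R).intervalIntegrable r R)]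
    simp
  obtain ⟨C, hC⟩ := exists_bound_hopPotential (R := R) (lam := lam) hcont
  have hI1 : Integrable (fun x => (if x ≤ R then 1 else 0) * hopPotential lam R h (rangeStep R r x))
      (expMeasure lam) := by
    refine Integrable.of_bound (C := C) (Measurable.aestronglyMeasurable
      ((Measurable.ite measurableSet_Iic measurable_const measurable_const).mul
        (hU.measurable.comp hstep))) ?_
    filter_upwards [ae_pos_expMeasure lam] with x hx
    split_ifs with h1
    · rw [one_mul]
      refine hC _ ?_
      rw [rangeStep]
      split_ifs <;> constructor <;> linarith
    · simpa using (abs_nonneg _).trans (hC 0 ⟨le_rfl, hr0.trans hrR⟩)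
  have hI2 : Integrable (fun x => h 0 * if r < x then 1 else 0) (expMeasure lam) := by
    refine Integrable.const_mul (Integrable.of_bound (C := 1) (Measurable.aestronglyMeasurable
      (Measurable.ite measurableSet_Ioi measurable_const measurable_const))
      (ae_of_all _ fun x => ?_)) _
    split_ifs <;> simp
  rw [integral_add hI1 hI2, hint, integral_const_mul, integral_expMeasure_indicator_gt hlam hr0,
    hopPotential]
  ring

/-! ### The scan as a Markov chain -/

lemma measurable_rangeStep (R : ℝ) : Measurable fun p : ℝ × ℝ => rangeStep R p.1 p.2 := by
  unfold rangeStep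
  exact Measurable.ite (measurableSet_le measurable_snd measurable_fst) (by fun_prop) (by fun_prop)

lemma measurable_remainingRange (R : ℝ) (m : ℕ) :
    Measurable fun g : ℕ → ℝ => remainingRange g R m := by
  induction m with
  | zero => exact measurable_const
  | succ m ih => exact (measurable_rangeStep R).comp (ih.prodMk (measurable_pi_apply m))

lemma measurable_connectedInd (R : ℝ) (m : ℕ) :
    Measurable fun g : ℕ → ℝ => connectedInd g R m :=
  Finset.measurable_fun_prod _ fun k _ =>
    Measurable.ite (measurableSet_le (measurable_pi_apply k) measurable_const) measurable_const
      measurable_const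

lemma measurable_retransmitInd (R : ℝ) (m : ℕ) :
    Measurable fun g : ℕ → ℝ => retransmitInd g R m :=
  (measurable_connectedInd R m).mul
    (Measurable.ite (measurableSet_lt (measurable_remainingRange R m) (measurable_pi_apply m))
      measurable_const measurable_const)

lemma remainingRange_congr {g g' : ℕ → ℝ} (R : ℝ) {m : ℕ} (h : ∀ k < m, g k = g' k) :
    remainingRange g R m = remainingRange g' R m := by
  induction m with
  | zero => rfl
  | succ m ih =>
    rw [remainingRange, remainingRange, ih fun k hk => h k (by omega), h m (by omega)]

lemma connectedInd_congr {g g' : ℕ → ℝ} (R : ℝ) {m : ℕ} (h : ∀ k < m, g k = g' k) :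
    connectedInd g R m = connectedInd g' R m :=
  Finset.prod_congr rfl fun k hk => by rw [h k (Finset.mem_range.1 hk)]

lemma ae_gap_pos {Ω : Type*} [MeasurableSpace Ω] {P : Measure Ω} {lam : ℝ} {I : ℕ → Ω → ℝ}
    (hmeas : ∀ k, Measurable (I k)) (hlaw : ∀ k, P.map (I k) = expMeasure lam) :
    ∀ᵐ ω ∂P, ∀ k, 0 < I k ω := by
  refine ae_all_iff.2 fun k => ?_
  have := ae_pos_expMeasure lam
  rw [← hlaw k] at this
  exact ae_of_ae_map (hmeas k).aemeasurable this

section Chain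

variable {Ω : Type*} [MeasurableSpace Ω] {P : Measure Ω} {lam R : ℝ} {I : ℕ → Ω → ℝ}

/-- On the component the remaining range stays in `[0, R]`, where the potential is bounded. -/
lemma exists_bound_hopPotential_scan (hR : 0 < R) (hmeas : ∀ k, Measurable (I k))
    (hlaw : ∀ k, P.map (I k) = expMeasure lam) {h : ℝ → ℝ} (hcont : Continuous h) :
    ∃ C, ∀ m, ∀ᵐ ω ∂P, ‖connectedInd (fun k => I k ω) R m *
      hopPotential lam R h (remainingRange (fun k => I k ω) R m)‖ ≤
        C * connectedInd (fun k => I k ω) R m := by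
  obtain ⟨C, hC⟩ := exists_bound_hopPotential (R := R) (lam := lam) hcont
  refine ⟨C, fun m => ?_⟩
  filter_upwards [ae_gap_pos hmeas hlaw] with ω hω
  rcases connectedInd_eq_one_or_zero (fun k => I k ω) R m with ⟨h1, h2⟩ | h2
  · rw [h2, one_mul, mul_one]
    exact hC _ (remainingRange_mem_Icc hω hR h1)
  · simp [h2]

/-- The state of the scan at vehicle `m` is determined by the gaps before it. -/
lemma indepFun_scan (hmeas : ∀ k, Measurable (I k)) (hindep : iIndepFun I P) (R : ℝ) (m : ℕ) :
    IndepFun (fun ω => (connectedInd (fun k => I k ω) R m, remainingRange (fun k => I k ω) R m))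
      (I m) P := by
  have h := hindep.indepFun_finset (Finset.range m) {m} (by simp) hmeas
  let ext : (Finset.range m → ℝ) → ℕ → ℝ :=
    fun x k => if hk : k ∈ Finset.range m then x ⟨k, hk⟩ else 0
  have hext : Measurable ext := by
    refine measurable_pi_lambda _ fun k => ?_
    by_cases hk : k ∈ Finset.range m
    · simp only [ext, dif_pos hk]
      exact measurable_pi_apply (⟨k, hk⟩ : Finset.range m)
    · simp only [ext, dif_neg hk]
      exact measurable_const
  have hlast : Measurable fun x : ({m} : Finset ℕ) → ℝ => x ⟨m, Finset.mem_singleton_self m⟩ :=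
    measurable_pi_apply _
  have h' := h.comp (φ := fun x => (connectedInd (ext x) R m, remainingRange (ext x) R m))
    (ψ := fun x => x ⟨m, Finset.mem_singleton_self m⟩)
    (((measurable_connectedInd R m).comp hext).prodMk ((measurable_remainingRange R m).comp hext))
    hlast
  convert! h' using 1
  ext1 ω
  have he : ∀ k < m, I k ω = ext (fun i => I i ω) k := fun k hk => by simp [ext, hk]
  simp only [Function.comp_apply]
  rw [← connectedInd_congr R he, ← remainingRange_congr R he]

variable [IsProbabilityMeasure P]

/-- Averaging over the next gap while the state of the scan is held fixed. -/
lemma integral_scan (hlam : 0 < lam) (hmeas : ∀ k, Measurable (I k)) (hindep : iIndepFun I P)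
    (hlaw : ∀ k, P.map (I k) = expMeasure lam) (m : ℕ) {F : (ℝ × ℝ) × ℝ → ℝ} (hF : Measurable F)
    (hint : Integrable (fun ω => F ((connectedInd (fun k => I k ω) R m,
      remainingRange (fun k => I k ω) R m), I m ω)) P) :
    ∫ ω, F ((connectedInd (fun k => I k ω) R m, remainingRange (fun k => I k ω) R m), I m ω) ∂P =
      ∫ ω, ∫ x, F ((connectedInd (fun k => I k ω) R m, remainingRange (fun k => I k ω) R m), x)
        ∂(expMeasure lam) ∂P := by
  have := isProbabilityMeasure_expMeasure hlam
  have hI : Measurable fun ω k => I k ω := measurable_pi_lambda _ hmeas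
  have hS : Measurable fun ω =>
      (connectedInd (fun k => I k ω) R m, remainingRange (fun k => I k ω) R m) :=
    ((measurable_connectedInd R m).comp hI).prodMk ((measurable_remainingRange R m).comp hI)
  have hSI := hS.prodMk (hmeas m)
  have hmap := (indepFun_scan hmeas hindep R m).map_prod_eq_prod_map_map hS.aemeasurable
    (hmeas m).aemeasurable
  have := Measure.isProbabilityMeasure_map hS.aemeasurable (μ := P)
  rw [hlaw] at hmap
  have hint' := (integrable_map_measure hF.aestronglyMeasurable hSI.aemeasurable).2 hint
  rw [hmap] at hint'
  rw [← integral_map hSI.aemeasurable hF.aestronglyMeasurable, hmap, integral_prod _ hint',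
    integral_map hS.aemeasurable
      (hF.stronglyMeasurable.integral_prod_right').aestronglyMeasurable]

lemma integrable_connectedInd (hmeas : ∀ k, Measurable (I k)) (m : ℕ) :
    Integrable (fun ω => connectedInd (fun k => I k ω) R m) P := by
  refine Integrable.of_bound (C := 1)
    ((measurable_connectedInd R m).comp (measurable_pi_lambda _ hmeas)).aestronglyMeasurable
    (ae_of_all _ fun ω => ?_)
  rw [Real.norm_of_nonneg (connectedInd_nonneg _ _ _)]
  exact connectedInd_le_one _ _ _

lemma integrable_retransmitInd (hmeas : ∀ k, Measurable (I k)) (m : ℕ) :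
    Integrable (fun ω => retransmitInd (fun k => I k ω) R m) P := by
  refine (integrable_connectedInd (R := R) hmeas m).mono'
    ((measurable_retransmitInd R m).comp (measurable_pi_lambda _ hmeas)).aestronglyMeasurable
    (ae_of_all _ fun ω => ?_)
  rw [Real.norm_of_nonneg (retransmitInd_nonneg _ _ _)]
  exact retransmitInd_le _ _ _

lemma integral_connectedInd (hlam : 0 < lam) (hR : 0 ≤ R) (hmeas : ∀ k, Measurable (I k))
    (hindep : iIndepFun I P) (hlaw : ∀ k, P.map (I k) = expMeasure lam) (m : ℕ) :
    ∫ ω, connectedInd (fun k => I k ω) R m ∂P = (1 - Real.exp (-(lam * R))) ^ m := by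
  induction m with
  | zero => simp [connectedInd]
  | succ m ih =>
    have hs : ∀ ω, connectedInd (fun k => I k ω) R (m + 1) =
        connectedInd (fun k => I k ω) R m * if I m ω ≤ R then 1 else 0 := fun ω => by
      rw [connectedInd, Finset.prod_range_succ]; rfl
    have hF : Measurable fun p : (ℝ × ℝ) × ℝ => p.1.1 * if p.2 ≤ R then 1 else 0 :=
      (by fun_prop : Measurable fun p : (ℝ × ℝ) × ℝ => p.1.1).mul (Measurable.ite
        (measurableSet_le measurable_snd measurable_const) measurable_const measurable_const)
    have hint := integrable_connectedInd (P := P) (R := R) hmeas (m + 1)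
    simp_rw [hs] at hint ⊢
    rw [integral_scan hlam hmeas hindep hlaw m hF hint]
    simp only [integral_const_mul, integral_expMeasure_indicator_le hlam hR, integral_mul_const, ih,
      pow_succ]

lemma integrable_hopPotential_scan (hR : 0 < R) (hmeas : ∀ k, Measurable (I k))
    (hlaw : ∀ k, P.map (I k) = expMeasure lam) {h : ℝ → ℝ} (hcont : Continuous h) (m : ℕ) :
    Integrable (fun ω => connectedInd (fun k => I k ω) R m *
      hopPotential lam R h (remainingRange (fun k => I k ω) R m)) P := by
  obtain ⟨C, hC⟩ := exists_bound_hopPotential_scan hR hmeas hlaw hcont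
  have hU : Continuous (hopPotential lam R h) := by unfold hopPotential; fun_prop
  have hI : Measurable fun ω k => I k ω := measurable_pi_lambda _ hmeas
  exact ((integrable_connectedInd hmeas m).const_mul C).mono'
    (((measurable_connectedInd R m).comp hI).mul
      (hU.measurable.comp ((measurable_remainingRange R m).comp hI))).aestronglyMeasurable (hC m)

/-- The mean of the potential over the event that vehicle `m` is in the component decreases by
`h 0` times the probability that this vehicle retransmits. -/
lemma integral_hopPotential_scan (hlam : 0 < lam) (hR : 0 < R) (hmeas : ∀ k, Measurable (I k))
    (hindep : iIndepFun I P) (hlaw : ∀ k, P.map (I k) = expMeasure lam) {h : ℝ → ℝ}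
    (hh : ∀ t, HasDerivAt h (lam * Real.exp (-(lam * t)) * h (R - t)) t) (m : ℕ) :
    ∫ ω, connectedInd (fun k => I k ω) R m *
        hopPotential lam R h (remainingRange (fun k => I k ω) R m) ∂P =
      ∫ ω, connectedInd (fun k => I k ω) R (m + 1) *
        hopPotential lam R h (remainingRange (fun k => I k ω) R (m + 1)) ∂P +
      h 0 * ∫ ω, retransmitInd (fun k => I k ω) R m ∂P := by
  have hcont : Continuous h := continuous_iff_continuousAt.2 fun t => (hh t).continuousAt
  have hU : Continuous (hopPotential lam R h) := by unfold hopPotential; fun_prop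
  have hint1 := integrable_hopPotential_scan hR hmeas hlaw hcont (m + 1)
  have hint2 := (integrable_retransmitInd (P := P) (R := R) hmeas m).const_mul (h 0)
  rw [← integral_const_mul, ← integral_add hint1 hint2]
  have hint := hint1.add hint2
  let F : (ℝ × ℝ) × ℝ → ℝ := fun p => p.1.1 *
    ((if p.2 ≤ R then 1 else 0) * hopPotential lam R h (rangeStep R p.1.2 p.2)
      + h 0 * if p.1.2 < p.2 then 1 else 0)
  have hF : Measurable F := by
    refine (by fun_prop : Measurable fun p : (ℝ × ℝ) × ℝ => p.1.1).mul ((Measurable.mul ?_ ?_).add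
      (Measurable.const_mul ?_ _))
    · exact Measurable.ite (measurableSet_le measurable_snd measurable_const) measurable_const
        measurable_const
    · exact hU.measurable.comp ((measurable_rangeStep R).comp
        (by fun_prop : Measurable fun p : (ℝ × ℝ) × ℝ => (p.1.2, p.2)))
    · exact Measurable.ite (measurableSet_lt (by fun_prop) measurable_snd) measurable_const
        measurable_const
  have hs : ∀ ω, connectedInd (fun k => I k ω) R (m + 1) *
        hopPotential lam R h (remainingRange (fun k => I k ω) R (m + 1)) +
      h 0 * retransmitInd (fun k => I k ω) R m =
      F ((connectedInd (fun k => I k ω) R m, remainingRange (fun k => I k ω) R m), I m ω) := by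
    intro ω
    have : connectedInd (fun k => I k ω) R (m + 1) =
        connectedInd (fun k => I k ω) R m * if I m ω ≤ R then 1 else 0 := by
      rw [connectedInd, Finset.prod_range_succ]; rfl
    rw [this, remainingRange, retransmitInd]
    simp only [F]
    ring
  have hint' := hint.congr (ae_of_all _ hs)
  rw [integral_congr_ae (ae_of_all _ hs), integral_scan hlam hmeas hindep hlaw m hF hint']
  refine integral_congr_ae ?_
  filter_upwards [ae_gap_pos hmeas hlaw] with ω hω
  simp only [F, integral_const_mul]
  rcases connectedInd_eq_one_or_zero (fun k => I k ω) R m with ⟨h1, h2⟩ | h2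
  · rw [integral_hopPotential hlam hh (remainingRange_mem_Icc hω hR h1)]
  · simp [h2]

lemma integral_retransmitInd_le (hlam : 0 < lam) (hR : 0 ≤ R) (hmeas : ∀ k, Measurable (I k))
    (hindep : iIndepFun I P) (hlaw : ∀ k, P.map (I k) = expMeasure lam) (m : ℕ) :
    ∫ ω, retransmitInd (fun k => I k ω) R m ∂P ≤ (1 - Real.exp (-(lam * R))) ^ m := by
  rw [← integral_connectedInd hlam hR hmeas hindep hlaw m]
  exact integral_mono (integrable_retransmitInd hmeas m) (integrable_connectedInd hmeas m)
    fun ω => retransmitInd_le _ _ _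

lemma one_sub_exp_mem_Ico (hlam : 0 < lam) (hR : 0 ≤ R) :
    1 - Real.exp (-(lam * R)) ∈ Set.Ico 0 1 := by
  have h1 := Real.exp_pos (-(lam * R))
  have h2 : Real.exp (-(lam * R)) ≤ 1 := Real.exp_le_one_iff.2 (by nlinarith)
  exact ⟨by linarith, by linarith⟩

lemma summable_integral_retransmitInd (hlam : 0 < lam) (hR : 0 ≤ R)
    (hmeas : ∀ k, Measurable (I k)) (hindep : iIndepFun I P)
    (hlaw : ∀ k, P.map (I k) = expMeasure lam) :
    Summable fun m => ∫ ω, retransmitInd (fun k => I k ω) R m ∂P := by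
  obtain ⟨h0, h1⟩ := one_sub_exp_mem_Ico hlam hR
  exact Summable.of_nonneg_of_le (fun m => integral_nonneg fun ω => retransmitInd_nonneg _ _ _)
    (integral_retransmitInd_le hlam hR hmeas hindep hlaw) (summable_geometric_of_lt_one h0 h1)

/-- Telescoping `integral_hopPotential_scan`: since the mean of the potential starts at `h R` and
tends to `0`, the expected number of retransmitters is `h R / h 0`. -/
lemma mul_tsum_integral_retransmitInd (hlam : 0 < lam) (hR : 0 < R)
    (hmeas : ∀ k, Measurable (I k))
    (hindep : iIndepFun I P) (hlaw : ∀ k, P.map (I k) = expMeasure lam) {h : ℝ → ℝ}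
    (hh : ∀ t, HasDerivAt h (lam * Real.exp (-(lam * t)) * h (R - t)) t) :
    h 0 * ∑' m, ∫ ω, retransmitInd (fun k => I k ω) R m ∂P = h R := by
  have hcont : Continuous h := continuous_iff_continuousAt.2 fun t => (hh t).continuousAt
  obtain ⟨h0, h1⟩ := one_sub_exp_mem_Ico hlam hR.le
  obtain ⟨C, hC⟩ := exists_bound_hopPotential_scan hR hmeas hlaw hcont
  set a : ℕ → ℝ := fun m => ∫ ω, connectedInd (fun k => I k ω) R m *
        hopPotential lam R h (remainingRange (fun k => I k ω) R m) ∂P with ha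
  have hstep := integral_hopPotential_scan hlam hR hmeas hindep hlaw hh
  have ha0 : a 0 = h R := by simp [ha, connectedInd, remainingRange, hopPotential_zero]
  have hbound : ∀ m, ‖a m‖ ≤ C * (1 - Real.exp (-(lam * R))) ^ m := fun m => by
    rw [← integral_connectedInd hlam hR.le hmeas hindep hlaw m, ← integral_const_mul]
    exact norm_integral_le_of_norm_le ((integrable_connectedInd hmeas m).const_mul C) (hC m)
  have hlim : Tendsto a atTop (𝓝 0) := squeeze_zero_norm hbound
    (by simpa using (tendsto_pow_atTop_nhds_zero_of_lt_one h0 h1).const_mul C)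
  have hsum : ∀ n, h 0 * ∑ m ∈ Finset.range n, ∫ ω, retransmitInd (fun k => I k ω) R m ∂P =
      h R - a n := by
    intro n
    induction n with
    | zero => simp [ha0]
    | succ n ih =>
      have := hstep n
      rw [Finset.sum_range_succ, mul_add, ih]
      simp only [ha]
      linarith
  have hl1 := ((summable_integral_retransmitInd hlam hR.le hmeas hindep
    hlaw).hasSum.tendsto_sum_nat).const_mul (h 0)
  simp_rw [hsum] at hl1
  exact tendsto_nhds_unique hl1 (by simpa using hlim.const_sub (h R))

/-! ### The number of hops -/

lemma measureReal_connectedInd_le (hmeas : ∀ k, Measurable (I k)) (m : ℕ) :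
    P.real {ω | 1 ≤ connectedInd (fun k => I k ω) R m} ≤
      ∫ ω, connectedInd (fun k => I k ω) R m ∂P := by
  simpa using mul_meas_ge_le_integral_of_nonneg
    (ae_of_all P fun ω => connectedInd_nonneg (fun k => I k ω) R m)
    (integrable_connectedInd hmeas m) 1

lemma ae_exists_gap_gt (hlam : 0 < lam) (hR : 0 ≤ R) (hmeas : ∀ k, Measurable (I k))
    (hindep : iIndepFun I P) (hlaw : ∀ k, P.map (I k) = expMeasure lam) :
    ∀ᵐ ω ∂P, ∃ k, R < I k ω := by
  obtain ⟨h0, h1⟩ := one_sub_exp_mem_Ico hlam hR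
  have hle : ∀ m, P.real {ω | ∀ k, I k ω ≤ R} ≤ (1 - Real.exp (-(lam * R))) ^ m := fun m => by
    rw [← integral_connectedInd hlam hR hmeas hindep hlaw m]
    refine (measureReal_mono fun ω hω => ?_).trans (measureReal_connectedInd_le hmeas m)
    exact (connectedInd_eq_one fun k _ => hω k).ge
  have hz : P.real {ω | ∀ k, I k ω ≤ R} = 0 := le_antisymm
    (ge_of_tendsto' (tendsto_pow_atTop_nhds_zero_of_lt_one h0 h1) hle) measureReal_nonneg
  rw [measureReal_eq_zero_iff] at hz
  rw [ae_iff]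
  simpa using hz

/-- Almost surely the component ends, and the description of the hops by the scan applies. -/
lemma ae_hasSum_retransmitInd (hlam : 0 < lam) (hR : 0 < R) (hmeas : ∀ k, Measurable (I k))
    (hindep : iIndepFun I P) (hlaw : ∀ k, P.map (I k) = expMeasure lam) :
    ∀ᵐ ω ∂P, (∃ n, R < hopLength (fun k => I k ω) R n) ∧
      HasSum (retransmitInd (fun k => I k ω) R) (hopCount (fun k => I k ω) R) ∧
      ∀ n < hopCount (fun k => I k ω) R, connectedInd (fun k => I k ω) R n = 1 := by
  filter_upwards [ae_gap_pos hmeas hlaw, ae_exists_gap_gt hlam hR.le hmeas hindep hlaw]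
    with ω h1 h2 using hasSum_retransmitInd h1 hR h2

lemma aemeasurable_hopCount (hlam : 0 < lam) (hR : 0 < R) (hmeas : ∀ k, Measurable (I k))
    (hindep : iIndepFun I P) (hlaw : ∀ k, P.map (I k) = expMeasure lam) :
    AEMeasurable (fun ω => hopCount (fun k => I k ω) R) P := by
  have hI : Measurable fun ω k => I k ω := measurable_pi_lambda _ hmeas
  have h : AEMeasurable (fun ω => (hopCount (fun k => I k ω) R : ℝ)) P :=
    aemeasurable_of_tendsto_metrizable_ae atTop
      (f := fun n ω => ∑ m ∈ Finset.range n, retransmitInd (fun k => I k ω) R m)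
      (fun n => (Finset.measurable_fun_sum _ fun m _ =>
        (measurable_retransmitInd R m).comp hI).aemeasurable)
      ((ae_hasSum_retransmitInd hlam hR hmeas hindep hlaw).mono fun ω hω =>
        hω.2.1.tendsto_sum_nat)
  exact (Nat.measurable_floor.comp_aemeasurable h).congr (ae_of_all _ fun ω => Nat.floor_natCast _)

lemma integral_hopCount (hlam : 0 < lam) (hR : 0 < R) (hmeas : ∀ k, Measurable (I k))
    (hindep : iIndepFun I P) (hlaw : ∀ k, P.map (I k) = expMeasure lam) :
    ∫ ω, (hopCount (fun k => I k ω) R : ℝ) ∂P =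
      ∑' m, ∫ ω, retransmitInd (fun k => I k ω) R m ∂P := by
  have h := hasSum_integral_of_summable_integral_norm (μ := P)
    (F := fun m ω => retransmitInd (fun k => I k ω) R m) (integrable_retransmitInd hmeas) (by
      simpa only [Real.norm_of_nonneg (retransmitInd_nonneg _ _ _)] using
        summable_integral_retransmitInd hlam hR.le hmeas hindep hlaw)
  rw [h.tsum_eq]
  refine integral_congr_ae ?_
  filter_upwards [ae_hasSum_retransmitInd hlam hR hmeas hindep hlaw] with ω hω
  exact hω.2.1.tsum_eq.symm

/-- The tail of the number of hops is geometrically small: after more than `n` hops, at least `n`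
gaps in a row are at most `R`. -/
lemma measureReal_hopCount_le (hlam : 0 < lam) (hR : 0 < R) (hmeas : ∀ k, Measurable (I k))
    (hindep : iIndepFun I P) (hlaw : ∀ k, P.map (I k) = expMeasure lam) (n : ℕ) :
    P.real {ω | hopCount (fun k => I k ω) R = n + 1} ≤ (1 - Real.exp (-(lam * R))) ^ n := by
  rw [← integral_connectedInd hlam hR.le hmeas hindep hlaw n]
  refine le_trans ?_ (measureReal_connectedInd_le hmeas n)
  refine ENNReal.toReal_mono (measure_ne_top _ _) (measure_mono_ae ?_)
  filter_upwards [ae_hasSum_retransmitInd hlam hR hmeas hindep hlaw] with ω hω h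
  exact (hω.2.2 n (by rw [show _ = n + 1 from h]; omega)).ge

end Chain

/-! ### The z-transform of a variable with geometric tails -/

lemma integrable_and_hasDerivAt_zTransform {Ω : Type*} [MeasurableSpace Ω] {P : Measure Ω}
    [IsProbabilityMeasure P] {N : Ω → ℕ} (hN : AEMeasurable N P) {q : ℝ} (h0 : 0 ≤ q) (h1 : q < 1)
    (htail : ∀ n, P.real {ω | N ω = n + 1} ≤ q ^ n) :
    Integrable (fun ω => (N ω : ℝ)) P ∧
      HasDerivAt (zTransform P N) (∫ ω, (N ω : ℝ) ∂P) 1 := by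
  -- A radius `ρ > 1` with `ρ * q < 1`, so that the series converges near `1`.
  obtain ⟨ρ, hρ1, hρq⟩ : ∃ ρ : ℝ, 1 < ρ ∧ ρ * q < 1 := by
    refine ⟨2 / (1 + q), by rw [lt_div_iff₀] <;> linarith, ?_⟩
    rw [div_mul_eq_mul_div, div_lt_one] <;> linarith
  have hρ0 : 0 < ρ := by linarith
  have hρq0 : 0 ≤ ρ * q := by positivity
  have hsum : Summable fun n : ℕ => ((n : ℝ) + 1) * (ρ * q) ^ n := by
    have e1 := summable_pow_mul_geometric_of_norm_lt_one 1 (r := ρ * q)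
      (by rwa [Real.norm_of_nonneg hρq0])
    have e2 := summable_geometric_of_lt_one hρq0 hρq
    refine (e1.add e2).congr fun n => by ring
  have hterm : ∀ n : ℕ, ∀ y ∈ Set.Ioo (-ρ) ρ,
      ‖P.real {ω | N ω = n + 1} * (((n : ℝ) + 1) * y ^ n)‖ ≤ ((n : ℝ) + 1) * (ρ * q) ^ n := by
    intro n y hy
    rw [norm_mul, norm_mul, norm_pow, Real.norm_of_nonneg measureReal_nonneg,
      Real.norm_of_nonneg (by positivity), mul_pow]
    have : ‖y‖ ≤ ρ := (abs_lt.2 hy).le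
    calc P.real {ω | N ω = n + 1} * (((n : ℝ) + 1) * ‖y‖ ^ n)
        ≤ q ^ n * (((n : ℝ) + 1) * ρ ^ n) := by
          gcongr
          exact htail n
      _ = _ := by ring
  have h1mem : (1 : ℝ) ∈ Set.Ioo (-ρ) ρ := ⟨by linarith, hρ1⟩
  have hder := hasDerivAt_tsum_of_isPreconnected (g := fun (n : ℕ) (z : ℝ) =>
      P.real {ω | N ω = n + 1} * z ^ (n + 1)) (t := Set.Ioo (-ρ) ρ) (y := 1) (y₀ := 0)
    hsum isOpen_Ioo isPreconnected_Ioo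
    (fun n y _ => by
      simpa using (hasDerivAt_pow (n + 1) y).const_mul (P.real {ω | N ω = n + 1}))
    (by simpa using hterm) ⟨by linarith, hρ0⟩ (by simp) h1mem
  have hsum1 : Summable fun n : ℕ => P.real {ω | N ω = n + 1} * ((n : ℝ) + 1) := by
    refine Summable.of_norm_bounded hsum fun n => ?_
    simpa using hterm n 1 h1mem
  have hreal : ∀ n, (P.map N).real {n} = P.real {ω | N ω = n} := fun n => by
    rw [map_measureReal_apply_of_aemeasurable hN (measurableSet_singleton n)]; rfl
  have hint : Integrable (fun n : ℕ => (n : ℝ)) (P.map N) := by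
    have hs : Summable fun n : ℕ => (P.map N).real {n} * ‖(n : ℝ)‖ := by
      refine (summable_nat_add_iff 1).1 (hsum1.congr fun n => ?_)
      rw [hreal, Real.norm_of_nonneg (by positivity)]
      push_cast
      rfl
    have := Measure.isProbabilityMeasure_map hN
    rw [← Measure.sum_smul_dirac (P.map N)]
    exact integrable_sum_dirac (fun n => measure_ne_top _ _) hs
  refine ⟨hint.comp_aemeasurable hN, ?_⟩
  have hE : ∫ ω, (N ω : ℝ) ∂P = ∑' n : ℕ, P.real {ω | N ω = n + 1} * ((n : ℝ) + 1) := by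
    rw [← integral_map (f := fun n : ℕ => (n : ℝ)) hN (by fun_prop), integral_countable hint]
    simp_rw [hreal, smul_eq_mul]
    rw [Summable.tsum_eq_zero_add ((summable_nat_add_iff 1).1 (by simpa using hsum1))]
    simp
  rw [hE]
  convert! hder using 1
  simp

/-! ### Solving the delay equation -/

section Solve

variable {lam R : ℝ}

/-- `hopRoot` makes `-(1 - s) / 2` and `-(1 + s) / 2` the roots of `x ^ 2 + x + ρ'`. -/
lemma hopRoot_sq {L : ℝ} (hL : Real.log 4 ≤ L) :
    hopRoot L ^ 2 = 1 - 4 * Real.exp (-L) := by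
  refine Real.sq_sqrt ?_
  have : Real.exp (-L) ≤ 1 / 4 := by
    rw [Real.exp_neg, one_div]
    gcongr
    rwa [← Real.log_le_iff_le_exp (by norm_num)]
  linarith

lemma hopRoot_pos {L : ℝ} (hL : Real.log 4 < L) : 0 < hopRoot L := by
  refine Real.sqrt_pos.2 ?_
  have : Real.exp (-L) < 1 / 4 := by
    rw [Real.exp_neg, one_div]
    gcongr
    rwa [← Real.log_lt_iff_lt_exp (by norm_num)]
  linarith

/-- A combination of the exponentials with the rates `λ x` and `λ y`, where `x` and `y` are the
roots of `X ^ 2 + X + ρ'`, that solves the delay equation. -/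
lemma hasDerivAt_delay_exp {x y : ℝ} (hadd : x + y = -1)
    (hmul : x * y = Real.exp (-(lam * R))) (t : ℝ) :
    HasDerivAt (fun t => y * Real.exp (lam * x * t) +
        Real.exp (lam * R * x) * Real.exp (lam * y * t))
      (lam * Real.exp (-(lam * t)) * (y * Real.exp (lam * x * (R - t)) +
        Real.exp (lam * R * x) * Real.exp (lam * y * (R - t)))) t := by
  have hexp (c : ℝ) : HasDerivAt (fun t => Real.exp (c * t)) (Real.exp (c * t) * (c * 1)) t :=
    ((hasDerivAt_id t).const_mul c).exp
  convert! ((hexp (lam * x)).const_mul y).add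
    ((hexp (lam * y)).const_mul (Real.exp (lam * R * x))) using 1
  obtain rfl : y = -1 - x := by linarith
  have e1 : Real.exp (-(lam * t)) * Real.exp (lam * x * (R - t)) =
      Real.exp (lam * R * x) * Real.exp (lam * (-1 - x) * t) := by
    rw [← Real.exp_add, ← Real.exp_add]; ring_nf
  have e2 : Real.exp (-(lam * t)) * (Real.exp (lam * R * x) *
      Real.exp (lam * (-1 - x) * (R - t))) =
      Real.exp (-(lam * R)) * Real.exp (lam * x * t) := by
    rw [← Real.exp_add, ← Real.exp_add, ← Real.exp_add]; ring_nf
  rw [mul_add, mul_assoc lam _ (Real.exp _ * _), e2, ← hmul]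
  linear_combination lam * (-1 - x) * e1

lemma exp_neg_log_four_half : Real.exp (-(Real.log 4 / 2)) = 1 / 2 := by
  have : Real.log 4 = 2 * Real.log 2 := by
    rw [show (4 : ℝ) = 2 ^ 2 by norm_num, Real.log_pow]; norm_num
  rw [this, mul_div_cancel_left₀ _ two_ne_zero, Real.exp_neg, Real.exp_log two_pos, one_div]

/-- The double-root case of `hasDerivAt_delay_exp`. -/
lemma hasDerivAt_delay_double (hL : lam * R = Real.log 4) (t : ℝ) :
    HasDerivAt (fun t => (2 - lam * R + 2 * (lam * t)) * Real.exp (-(lam * t / 2)))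
      (lam * Real.exp (-(lam * t)) *
        ((2 - lam * R + 2 * (lam * (R - t))) * Real.exp (-(lam * (R - t) / 2)))) t := by
  have h1 : HasDerivAt (fun t => 2 - lam * R + 2 * (lam * t)) (2 * (lam * 1)) t :=
    (((hasDerivAt_id t).const_mul lam).const_mul 2).const_add _
  have h2 : HasDerivAt (fun t => Real.exp (-(lam * t / 2)))
      (Real.exp (-(lam * t / 2)) * (-(lam * 1 / 2))) t :=
    (((hasDerivAt_id t).const_mul lam).div_const 2).neg.exp
  convert! h1.mul h2 using 1
  have hhalf : Real.exp (-(lam * R / 2)) = 1 / 2 := by rw [hL, exp_neg_log_four_half]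
  have e : Real.exp (-(lam * t)) * Real.exp (-(lam * (R - t) / 2)) =
      1 / 2 * Real.exp (-(lam * t / 2)) := by
    rw [← hhalf, ← Real.exp_add, ← Real.exp_add]; ring_nf
  linear_combination lam * (2 - lam * R + 2 * (lam * (R - t))) * e

end Solve

lemma log_four_lt_two : Real.log 4 < 2 := by
  rw [show (4 : ℝ) = 2 ^ 2 by norm_num, Real.log_pow]
  have := Real.log_two_lt_d9
  push_cast
  linarith

/-- The closed form in terms of `exp (λ' x)` with the root `x = -(1 - s) / 2`: up to nonzero factors,
its numerator is `exp (λ' x) + x` and its denominator `(1 + s) / 2 - exp (λ' x)`. -/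
lemma meanHopsNum_eq_and_meanHopsDen_eq {L : ℝ} (hL : Real.log 4 ≤ L) :
    meanHopsNum L = Real.exp (L / 2) *
      (Real.exp (L * (-(1 - hopRoot L) / 2)) - (1 - hopRoot L) / 2) ∧
    meanHopsDen L = Real.exp (L / 2) * (2 / (1 + hopRoot L) *
      ((1 + hopRoot L) / 2 - Real.exp (L * (-(1 - hopRoot L) / 2)))) := by
  have hs : 0 ≤ hopRoot L := Real.sqrt_nonneg _
  have hsq := hopRoot_sq hL
  unfold meanHopsDen meanHopsNum
  set s := hopRoot L
  have hx : Real.exp (L * (-(1 - s) / 2)) = Real.exp (-(L / 2)) * Real.exp (L / 2 * s) := by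
    rw [← Real.exp_add]; ring_nf
  have hp : Real.exp (-L) = Real.exp (-(L / 2)) * Real.exp (-(L / 2)) := by
    rw [← Real.exp_add]; ring_nf
  have hi : Real.exp (-(L / 2)) * Real.exp (L / 2) = 1 := by rw [← Real.exp_add]; simp
  rw [hx]
  rw [hp] at hsq
  set a := Real.exp (-(L / 2))
  set b := Real.exp (L / 2 * s)
  set c := Real.exp (L / 2)
  have h1s : 1 + s ≠ 0 := by positivity
  have hK : 2 / (1 + s) * (1 + s) = 2 := div_mul_cancel₀ _ h1s
  have hx' : (1 - s) / 2 = 2 / (1 + s) * (a * a) := by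
    field_simp
    linarith
  generalize 2 / (1 + s) = K at hK hx'
  constructor
  · linear_combination c * hx' + (K * a - b) * hi
  · linear_combination (-(c / 2)) * hK + K * b * hi

/-- If `E` satisfies the linear equation given by the exponential solution of the delay equation,
the closed form follows. The denominator cannot vanish, because then the numerator would vanish
too, and the two roots would coincide. -/
lemma eq_meanHopsNum_div_meanHopsDen {L E : ℝ} (hL : Real.log 4 < L)
    (hE : (-(1 + hopRoot L) / 2 + Real.exp (L * (-(1 - hopRoot L) / 2))) * E =
      -(1 + hopRoot L) / 2 * (Real.exp (L * (-(1 - hopRoot L) / 2)) + -(1 - hopRoot L) / 2)) :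
    meanHopsDen L ≠ 0 ∧ E = meanHopsNum L / meanHopsDen L := by
  have hs := hopRoot_pos hL
  obtain ⟨hnum, hden⟩ := meanHopsNum_eq_and_meanHopsDen_eq hL.le
  rw [hnum, hden]
  set s := hopRoot L
  generalize Real.exp (L * (-(1 - s) / 2)) = e at hE
  have h1s : 1 + s ≠ 0 := by positivity
  have hD : (1 + s) / 2 - e ≠ 0 := by
    intro h0
    have h2 : (1 + s) / 2 * (e + -(1 - s) / 2) = 0 := by linear_combination hE + E * h0
    have h3 : e + -(1 - s) / 2 = 0 := (mul_eq_zero.1 h2).resolve_left (by positivity)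
    linarith
  have hden0 : Real.exp (L / 2) * (2 / (1 + s) * ((1 + s) / 2 - e)) ≠ 0 :=
    mul_ne_zero (Real.exp_ne_zero _) (mul_ne_zero (by positivity) hD)
  refine ⟨hden0, ?_⟩
  have hK : 2 / (1 + s) * (1 + s) = 2 := div_mul_cancel₀ _ h1s
  rw [eq_div_iff hden0]
  generalize 2 / (1 + s) = K at hK
  linear_combination (-(K * Real.exp (L / 2))) * hE +
    (Real.exp (L / 2) / 2 * (e - (1 - s) / 2)) * hK

lemma tendsto_hopRoot : Tendsto hopRoot (𝓝[>] Real.log 4) (𝓝[≠] 0) := by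
  have hc : Continuous hopRoot := by unfold hopRoot; fun_prop
  have h0 : hopRoot (Real.log 4) = 0 := by
    rw [hopRoot, Real.exp_neg, Real.exp_log (by norm_num)]; norm_num
  refine tendsto_nhdsWithin_iff.2 ⟨?_, ?_⟩
  · simpa only [h0] using (hc.tendsto (Real.log 4)).mono_left nhdsWithin_le_nhds
  · filter_upwards [self_mem_nhdsWithin] with L hL using (hopRoot_pos hL).ne'

/-- As a function of the root `s`, both the numerator and the denominator of the closed form vanish
at `s = 0`, where they are differentiable; the limit is the quotient of their derivatives. -/
lemma tendsto_meanHopsNum_div_meanHopsDen :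
    Tendsto (fun L => meanHopsNum L / meanHopsDen L) (𝓝[>] Real.log 4)
      (𝓝 ((1 + Real.log 4 / 2) / (2 - Real.log 4))) := by
  set φ : ℝ → ℝ := fun s => Real.exp ((1 - s) / 2 * Real.log ((1 - s ^ 2) / 4)) with hφ
  have hlog : Real.log (1 / 4) = -Real.log 4 := by rw [one_div, Real.log_inv]
  have hφ0 : φ 0 = 1 / 2 := by
    rw [← exp_neg_log_four_half]
    simp only [hφ]
    rw [show (1 - (0 : ℝ) ^ 2) / 4 = 1 / 4 by norm_num, hlog]
    ring_nf
  have hd : HasDerivAt φ (Real.log 4 / 4) 0 := by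
    have d1 : HasDerivAt (fun s : ℝ => (1 - s) / 2) (-1 / 2) 0 :=
      ((hasDerivAt_id (0 : ℝ)).const_sub 1).div_const 2
    have d2 : HasDerivAt (fun s : ℝ => (1 - s ^ 2) / 4) 0 0 := by
      simpa using (((hasDerivAt_pow 2 (0 : ℝ)).const_sub 1).div_const 4)
    have d3 := (d1.mul (d2.log (by norm_num))).exp
    convert! d3 using 1
    have : Real.exp ((1 - 0) / 2 * Real.log ((1 - (0 : ℝ) ^ 2) / 4)) = 1 / 2 := hφ0
    simp only [Pi.mul_apply, this]
    rw [show (1 - (0 : ℝ) ^ 2) / 4 = 1 / 4 by norm_num, hlog]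
    ring
  have hN : HasDerivAt (fun s => φ s - (1 - s) / 2) (Real.log 4 / 4 + 1 / 2) 0 := by
    convert! hd.sub (((hasDerivAt_id (0 : ℝ)).const_sub 1).div_const 2) using 1
    ring
  have hD : HasDerivAt (fun s => (1 + s) / 2 - φ s) (1 / 2 - Real.log 4 / 4) 0 := by
    convert! (((hasDerivAt_id (0 : ℝ)).const_add 1).div_const 2).sub hd using 1
  have h2 : 2 - Real.log 4 ≠ 0 := by linarith [log_four_lt_two]
  have hquot := (hN.tendsto_slope_zero.div hD.tendsto_slope_zero
    (by intro h; apply h2; linarith)).comp tendsto_hopRoot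
  have hk : Tendsto (fun L => (1 + hopRoot L) / 2) (𝓝[>] Real.log 4) (𝓝 ((1 + 0) / 2)) :=
    ((tendsto_hopRoot.mono_right nhdsWithin_le_nhds).const_add 1).div_const 2
  have hlim := hk.mul hquot
  have hval : (1 + 0) / 2 * ((Real.log 4 / 4 + 1 / 2) / (1 / 2 - Real.log 4 / 4)) =
      (1 + Real.log 4 / 2) / (2 - Real.log 4) := by
    have : 1 / 2 - Real.log 4 / 4 = (2 - Real.log 4) / 4 := by ring
    rw [this]
    field_simp
    ring
  rw [hval] at hlim
  refine hlim.congr' ?_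
  filter_upwards [self_mem_nhdsWithin] with L hL
  have hs := hopRoot_pos hL
  obtain ⟨hnum, hden⟩ := meanHopsNum_eq_and_meanHopsDen_eq (le_of_lt hL)
  have he : Real.exp (L * (-(1 - hopRoot L) / 2)) = φ (hopRoot L) := by
    have : (1 - hopRoot L ^ 2) / 4 = Real.exp (-L) := by rw [hopRoot_sq (le_of_lt hL)]; ring
    simp only [hφ, this, Real.log_exp]
    ring_nf
  rw [hnum, hden, he, mul_div_mul_left _ _ (Real.exp_ne_zero _), div_mul_eq_div_div]
  simp only [Function.comp_apply, Pi.div_apply, zero_add, hφ0, smul_eq_mul]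
  rw [mul_div_mul_left _ _ (inv_ne_zero hs.ne')]
  norm_num
  field_simp

theorem mainTheorem5 {Ω : Type*} [MeasurableSpace Ω] (P : Measure Ω) [IsProbabilityMeasure P]
    (lam R : ℝ) (hlam : 0 < lam) (hdense : Real.log 4 ≤ lam * R)
    (I : ℕ → Ω → ℝ) (hmeas : ∀ k, Measurable (I k)) (hindep : iIndepFun I P)
    (hlaw : ∀ k, P.map (I k) = expMeasure lam) :
    (∀ᵐ ω ∂P, ∃ n, R < hopLength (fun k => I k ω) R n) ∧
    Integrable (fun ω => (hopCount (fun k => I k ω) R : ℝ)) P ∧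
    HasDerivAt (zTransform P (fun ω => hopCount (fun k => I k ω) R))
      (∫ ω, (hopCount (fun k => I k ω) R : ℝ) ∂P) 1 ∧
    (Real.log 4 < lam * R →
      meanHopsDen (lam * R) ≠ 0 ∧
      ∫ ω, (hopCount (fun k => I k ω) R : ℝ) ∂P
        = meanHopsNum (lam * R) / meanHopsDen (lam * R)) ∧
    (lam * R = Real.log 4 →
      Tendsto (fun L => meanHopsNum L / meanHopsDen L) (𝓝[>] Real.log 4)
        (𝓝 (∫ ω, (hopCount (fun k => I k ω) R : ℝ) ∂P))) := by
  have hlog : 0 < Real.log 4 := Real.log_pos (by norm_num)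
  have hR : 0 < R := pos_of_mul_pos_right (hlog.trans_le hdense) hlam.le
  obtain ⟨h0, h1⟩ := one_sub_exp_mem_Ico hlam hR.le
  obtain ⟨hint, hder⟩ := integrable_and_hasDerivAt_zTransform
    (aemeasurable_hopCount hlam hR hmeas hindep hlaw) h0 h1
    (measureReal_hopCount_le hlam hR hmeas hindep hlaw)
  refine ⟨(ae_hasSum_retransmitInd hlam hR hmeas hindep hlaw).mono fun ω hω => hω.1, hint, hder,
    fun hL => ?_, fun hL => ?_⟩
  · have hsq := hopRoot_sq hdense
    have hE := mul_tsum_integral_retransmitInd hlam hR hmeas hindep hlaw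
      (hasDerivAt_delay_exp (x := -(1 - hopRoot (lam * R)) / 2)
        (y := -(1 + hopRoot (lam * R)) / 2) (by ring) (by linear_combination -hsq / 4))
    rw [← integral_hopCount hlam hR hmeas hindep hlaw] at hE
    refine eq_meanHopsNum_div_meanHopsDen hL ?_
    set s := hopRoot (lam * R)
    have e1 : Real.exp (lam * R * (-(1 - s) / 2)) * Real.exp (lam * (-(1 + s) / 2) * R) =
        Real.exp (-(lam * R)) := by
      rw [← Real.exp_add]; ring_nf
    have e2 : lam * (-(1 - s) / 2) * R = lam * R * (-(1 - s) / 2) := by ring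
    simp only [mul_zero, Real.exp_zero, mul_one, e1, e2] at hE
    linear_combination hE + hsq / 4
  · have hE := mul_tsum_integral_retransmitInd hlam hR hmeas hindep hlaw
      (hasDerivAt_delay_double hL)
    rw [← integral_hopCount hlam hR hmeas hindep hlaw] at hE
    have hlt := log_four_lt_two
    have hhalf : Real.exp (-(Real.log 4 / 2)) = 1 / 2 := exp_neg_log_four_half
    simp only [hL, mul_zero, zero_div, neg_zero, Real.exp_zero, mul_one, add_zero, hhalf] at hE
    convert tendsto_meanHopsNum_div_meanHopsDen using 2
    rw [eq_div_iff (by linarith)]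
    linear_combination hE
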